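/- An inversion sequence of length $n$ is an integer sequence $(a_1,\dots,a_n)$ with $0\le a_i<i$ for all $i$. Let $\mathcal I_n(-,\neq,>)$ be the set of inversion sequences of length $n$ for which there are no $i<j<k$ with $a_j\neq a_k$ and $a_i>a_k$ (so $|\mathcal I_0(-,\neq,>)|=1$), and let $A(1,1)=\sum_{n\ge 0}|\mathcal I_n(-,\neq,>)|\,z^n$ be the generating function of this class. Then the following hold. (1) For every $n$, $\mathcal I_n(-,\neq,>)=\mathcal I_n(110,120,201,210)$, the set of inversion sequences of length $n$ in which no subsequence is order-isomorphic to one of the words $110,120,201,210$. (2) The quartic (in $x$) kernel $$K(z,x)=z^2x^4-(z^2+2z)x^3+(3z+1)x^2-(2z+2)x+1$$ has exactly two roots $X_1,X_2$ among the formal series in $z$ with complex coefficients and a well-ordered set of nonnegative rational exponents (in particular, among Puiseux series without negative exponents). Any other root, in the field of formal series in $z$ with complex coefficients and well-ordered sets of rational exponents, has negative order, i.e. diverges as $z\to0$. Both $X_1$ and $X_2$ are power series in $z^{1/2}$, and $$X_1=1-z^{1/2}+z-2z^{3/2}+\tfrac72z^2-\tfrac{13}2z^{5/2}+13z^3+\cdots,$$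 $$X_2=1+z^{1/2}+z+2z^{3/2}+\tfrac72z^2+\tfrac{13}2z^{5/2}+13z^3+\cdots.$$ (3) The denominator below is nonzero, and $$A(1,1)=\frac{(X_1-1)(X_2-1)(zX_1X_2-1)}{X_1X_2\,z\,(X_1X_2z-X_1z-X_2z+z+1)}$$ $$=1+z+2z^2+6z^3+22z^4+90z^5+396z^6+1833z^7+8801z^8+43441z^9+219092z^{10}+\cdots.$$ (4) $A=A(1,1)$ is algebraic over $\mathbb Q(z)$, its minimal polynomial over $\mathbb Q(z)$ has degree $6$, and it satisfies $$(3z^3+z)A^6-(2z^3+6z^2+3z+1)A^5+(11z^2+5z+5)A^4-(5z^2+7z+10)A^3+(6z+10)A^2-(2z+5)A+1=0.$$ -/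

import Mathlib

-- The inclusion of the field of rational functions in the field of formal Laurent series.
open scoped RatFunc

namespace InvSeq

/-- An inversion sequence of length `n`: with the entries indexed from `0`, the entry at index `i`
(the `(i+1)`-st entry) is one of `0, …, i`. -/
def IsInversionSeq {n : ℕ} (a : Fin n → ℕ) : Prop :=
  ∀ i : Fin n, a i < (i : ℕ) + 1

/-- The inversion sequences of length `n` that avoid the triple of binary relations
`(ρ₁, ρ₂, ρ₃)`. -/
def relClass (ρ₁ ρ₂ ρ₃ : ℕ → ℕ → Prop) (n : ℕ) : Set (Fin n → ℕ) :=
  {a | IsInversionSeq a ∧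
    ¬ ∃ i j k : Fin n, i < j ∧ j < k ∧ ρ₁ (a i) (a j) ∧ ρ₂ (a j) (a k) ∧ ρ₃ (a i) (a k)}

/-- The relation `-`, which imposes no restriction. -/
def noRestriction (_ _ : ℕ) : Prop := True

/-- The reduction of a word: each entry is replaced by the number of distinct values occurring in
the word that are smaller than it. -/
def reduction {k : ℕ} (w : Fin k → ℕ) : Fin k → ℕ :=
  fun i => ((Finset.univ.image w).filter (fun v => v < w i)).card

/-- `a` contains the pattern `σ`: some (not necessarily consecutive) subsequence of `a` has
reduction `σ`. -/
def Contains {n k : ℕ} (a : Fin n → ℕ) (σ : Fin k → ℕ) : Prop :=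
  ∃ f : Fin k → Fin n, StrictMono f ∧ reduction (a ∘ f) = σ

/-- The inversion sequences of length `n` that avoid every pattern in `S`. -/
def patClass {k : ℕ} (S : Set (Fin k → ℕ)) (n : ℕ) : Set (Fin n → ℕ) :=
  {a | IsInversionSeq a ∧ ∀ σ ∈ S, ¬ Contains a σ}

/-- The generating function `∑ₙ |𝓘ₙ| zⁿ`, over a field of characteristic zero such as `ℚ` or `ℂ`,
of the class of inversion sequences that avoid the triple `(-, ≠, >)`. -/
noncomputable def genFun (F : Type*) [Field F] : PowerSeries F :=
  PowerSeries.mk fun n => ((relClass noRestriction (· ≠ ·) (· > ·) n).ncard : F)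

/-- The quartic kernel, as a polynomial in `x` with coefficients depending on `z`. -/
def kernel {R : Type*} [CommRing R] (z x : R) : R :=
  z ^ 2 * x ^ 4 - (z ^ 2 + 2 * z) * x ^ 3 + (3 * z + 1) * x ^ 2 - (2 * z + 2) * x + 1

/-- The field of formal series in `z` with complex coefficients and well-ordered sets of rational
exponents. It contains the field of Puiseux series in `z`. -/
abbrev Series : Type := HahnSeries ℚ ℂ

/-- The variable `z`. -/
noncomputable def zVar : Series := HahnSeries.single 1 1

/-- `X` is a power series in `z ^ (1/2)`, that is, a Puiseux series all of whose exponents are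
nonnegative integer multiples of `1/2`. -/
def IsPowerSeriesInSqrt (X : Series) : Prop :=
  ∀ q ∈ X.support, ∃ k : ℕ, q = (k : ℚ) / 2

end InvSeq

/-!
An avoider can be extended by any entry between its maximum and its length, and by certain entries
below its maximum. If `k` is the difference between its length and its maximum, and `c` the number
of those lower entries, then its children have the labels `(k + 1, 1)`, `c` times, and
`(j + 1, k - j)` for `0 ≤ j ≤ k`. This gives a functional equation with one catalytic variable `x`,
whose kernel `K(z, 1 / (z * x))` has two roots regular at `z = 0`. Instead of substituting these
roots for `x`, one divides the right-hand side of the equation, a cubic polynomial in `x`, by the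
monic quadratic factor of the kernel that has them as roots. The quotient is linear in `x` and is
read off from two coefficients; at `x = 1` it gives the generating function in terms of the sum and
the product of `X₁` and `X₂`. Eliminating these two from their relations gives the sextic equation.
It is cubic in `z`, and its irreducibility follows from that of the cubic at `A = 2`.
The roots `X₁` and `X₂` both tend to `1`, and are separated by the substitution
`z = w ^ 2`, `x = 1 + w * y / 2`, after which Hensel's lemma applies.
-/

namespace InvSeq

theorem reduction_lt_iff {k : ℕ} (w : Fin k → ℕ) (i j : Fin k) :
    reduction w i < reduction w j ↔ w i < w j := by
  have mono : ∀ i j, w i ≤ w j → reduction w i ≤ reduction w j := fun i j h =>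
    Finset.card_le_card (Finset.monotone_filter_right _ fun _ _ hv => hv.trans_le h)
  refine ⟨fun h => not_le.mp fun hc => (mono j i hc).not_gt h, fun h => Finset.card_lt_card ?_⟩
  refine (Finset.ssubset_iff_of_subset
    (Finset.monotone_filter_right _ fun _ _ hv => hv.trans h)).mpr ⟨w i, ?_, ?_⟩
  · simpa using h
  · simp

theorem reduction_mem_patterns_iff (w : Fin 3 → ℕ) :
    reduction w ∈ ({![1, 1, 0], ![1, 2, 0], ![2, 0, 1], ![2, 1, 0]} : Set (Fin 3 → ℕ)) ↔
      w 1 ≠ w 2 ∧ w 2 < w 0 := by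
  refine ⟨fun h => ?_, fun ⟨hne, hlt⟩ => ?_⟩
  · have h12 := reduction_lt_iff w 1 2
    have h21 := reduction_lt_iff w 2 1
    have h20 := reduction_lt_iff w 2 0
    rcases h with h | h | h | h <;> rw [h] at h12 h21 h20 <;> simp at h12 h21 h20 <;> omega
  · have hred : ∀ i, reduction w i = (({w 0, w 1, w 2} : Finset ℕ).filter (· < w i)).card := by
      intro i
      have himage : Finset.univ.image w = {w 0, w 1, w 2} := by
        ext v; simp [Fin.exists_fin_succ, eq_comm]
      rw [reduction, himage]
    have hcases : w 0 = w 1 ∨ w 0 < w 1 ∨ w 1 < w 2 ∨ (w 2 < w 1 ∧ w 1 < w 0) := by omega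
    simp only [Set.mem_insert_iff, Set.mem_singleton_iff, funext_iff, Fin.forall_fin_succ, hred,
      Finset.filter_insert, Finset.filter_singleton]
    rcases hcases with h | h | h | ⟨h, h'⟩
    · left
      have h12 : w 2 < w 1 := h ▸ hlt
      simp [h, h12, h12.not_gt]
    · right; left
      simp [h, h.not_gt, hlt, hlt.ne', hlt.not_gt, hlt.trans h, (hlt.trans h).not_gt]
    · right; right; left
      simp [h, h.ne, h.not_gt, hlt, hlt.not_gt, h.trans hlt, (h.trans hlt).not_gt]
    · right; right; right
      simp [h, h.ne', h.not_gt, h', h'.not_gt, hlt, hlt.not_gt]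

theorem exists_strictMono_fin_three_iff {n : ℕ} (P : Fin n → Fin n → Fin n → Prop) :
    (∃ f : Fin 3 → Fin n, StrictMono f ∧ P (f 0) (f 1) (f 2)) ↔
      ∃ i j k, i < j ∧ j < k ∧ P i j k := by
  refine ⟨fun ⟨f, hf, h⟩ => ⟨f 0, f 1, f 2, hf (by decide), hf (by decide), h⟩,
    fun ⟨i, j, k, hij, hjk, h⟩ => ⟨![i, j, k], ?_, h⟩⟩
  rw [Fin.strictMono_iff_lt_succ]
  intro m
  fin_cases m
  exacts [hij, hjk]

theorem avoids_iff_not_exists_reduction_mem {n k : ℕ} (a : Fin n → ℕ) (S : Set (Fin k → ℕ)) :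
    (∀ σ ∈ S, ¬ Contains a σ) ↔
      ¬ ∃ f : Fin k → Fin n, StrictMono f ∧ reduction (a ∘ f) ∈ S := by
  refine ⟨fun h ⟨f, hf, hS⟩ => h _ hS ⟨f, hf, rfl⟩, ?_⟩
  rintro h _ hS ⟨f, hf, rfl⟩
  exact h ⟨f, hf, hS⟩

theorem relClass_eq_patClass (n : ℕ) : relClass noRestriction (· ≠ ·) (· > ·) n =
    patClass {![1, 1, 0], ![1, 2, 0], ![2, 0, 1], ![2, 1, 0]} n := by
  ext a
  refine and_congr_right fun _ => ?_
  rw [avoids_iff_not_exists_reduction_mem]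
  simp only [reduction_mem_patterns_iff, Function.comp_apply,
    exists_strictMono_fin_three_iff fun i j k => a j ≠ a k ∧ a k < a i,
    noRestriction, true_and, gt_iff_lt]

/-- The entry `w` may be appended to `a` without creating the forbidden triple. -/
def Admits {n : ℕ} (a : Fin n → ℕ) (w : ℕ) : Prop :=
  ∀ i j, i < j → w < a i → a j = w

/-- The largest entry of `a`, which is `0` for the empty word. -/
def maxEntry {n : ℕ} (a : Fin n → ℕ) : ℕ := Finset.univ.sup a

open Classical in
/-- The entries below the maximum that may be appended to `a`. The others that may be appended are
exactly the `n - maxEntry a + 1` values from `maxEntry a` to `n`. -/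
noncomputable def lowEntries {n : ℕ} (a : Fin n → ℕ) : Finset ℕ :=
  (Finset.range (maxEntry a)).filter (Admits a)

/-- The label of `a` in the generating tree: its distance from the largest possible value of the
next entry to its maximum, and its number of low entries. -/
noncomputable def label {n : ℕ} (a : Fin n → ℕ) : ℕ × ℕ := (n - maxEntry a, (lowEntries a).card)

theorem le_maxEntry {n : ℕ} (a : Fin n → ℕ) (i : Fin n) : a i ≤ maxEntry a :=
  Finset.le_sup (Finset.mem_univ i)

theorem maxEntry_snoc {n : ℕ} (a : Fin n → ℕ) (w : ℕ) :
    maxEntry (Fin.snoc a w : Fin (n + 1) → ℕ) = max (maxEntry a) w := by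
  simp [maxEntry, Fin.univ_castSuccEmb, Finset.sup_map, Function.comp_def, max_comm]

theorem maxEntry_le_of_isInversionSeq {n : ℕ} {a : Fin n → ℕ} (ha : IsInversionSeq a) :
    maxEntry a ≤ n :=
  Finset.sup_le fun i _ => (Nat.lt_succ_iff.mp (ha i)).trans i.isLt.le

theorem admits_of_maxEntry_le {n : ℕ} {a : Fin n → ℕ} {w : ℕ} (h : maxEntry a ≤ w) :
    Admits a w := fun i _ _ hw => absurd ((le_maxEntry a i).trans h) hw.not_ge

theorem lt_maxEntry_iff {n : ℕ} {a : Fin n → ℕ} {w : ℕ} : w < maxEntry a ↔ ∃ i, w < a i := by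
  simp [maxEntry, Finset.lt_sup_iff]

theorem admits_snoc_iff {n : ℕ} {a : Fin n → ℕ} {w v : ℕ} :
    Admits (Fin.snoc a w : Fin (n + 1) → ℕ) v ↔ Admits a v ∧ (v < maxEntry a → w = v) := by
  simp only [Admits, lt_maxEntry_iff, Fin.forall_fin_succ', Fin.snoc_castSucc, Fin.snoc_last,
    Fin.castSucc_lt_castSucc_iff, Fin.castSucc_lt_last, (Fin.castSucc_lt_last _).not_gt]
  grind

theorem relClass_finite (n : ℕ) : (relClass noRestriction (· ≠ ·) (· > ·) n).Finite :=
  (Set.Finite.pi' fun _ => Set.finite_Iio (n + 1)).subset fun _ ha i =>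
    (ha.1 i).trans (Nat.succ_lt_succ i.isLt)

/-- The class of inversion sequences that avoid `(-, ≠, >)`, as a finite set. -/
noncomputable def avoiders (n : ℕ) : Finset (Fin n → ℕ) := (relClass_finite n).toFinset

theorem mem_avoiders_iff {n : ℕ} {a : Fin n → ℕ} :
    a ∈ avoiders n ↔ IsInversionSeq a ∧ ∀ i j k, i < j → j < k → a k < a i → a j = a k := by
  simp only [avoiders, relClass, noRestriction, ne_eq, gt_iff_lt, true_and,
    Set.Finite.mem_toFinset, Set.mem_ofPred_eq, and_congr_right_iff]
  grind

theorem snoc_mem_avoiders_iff {n : ℕ} {a : Fin n → ℕ} {w : ℕ} :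
    (Fin.snoc a w : Fin (n + 1) → ℕ) ∈ avoiders (n + 1) ↔
      a ∈ avoiders n ∧ w ≤ n ∧ Admits a w := by
  simp only [mem_avoiders_iff, IsInversionSeq, Admits, Fin.forall_fin_succ', Fin.snoc_castSucc,
    Fin.snoc_last, Fin.castSucc_lt_castSucc_iff, Fin.castSucc_lt_last, Fin.val_castSucc,
    Fin.val_last, (Fin.castSucc_lt_last _).not_gt, lt_irrefl, Nat.lt_succ_iff]
  grind

theorem avoiders_zero : avoiders 0 = {Fin.elim0} := by
  ext a
  simp [mem_avoiders_iff, IsInversionSeq, Subsingleton.elim a Fin.elim0]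

theorem mem_lowEntries_iff {n : ℕ} {a : Fin n → ℕ} {w : ℕ} :
    w ∈ lowEntries a ↔ w < maxEntry a ∧ Admits a w := by
  simp [lowEntries]

theorem lowEntries_snoc_of_mem {n : ℕ} {a : Fin n → ℕ} {w : ℕ} (hw : w ∈ lowEntries a) :
    lowEntries (Fin.snoc a w : Fin (n + 1) → ℕ) = {w} := by
  ext v
  simp only [mem_lowEntries_iff, maxEntry_snoc, admits_snoc_iff,
    Finset.mem_singleton] at hw ⊢
  grind

theorem lowEntries_snoc_of_maxEntry_le {n : ℕ} {a : Fin n → ℕ} {w : ℕ} (hw : maxEntry a ≤ w) :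
    lowEntries (Fin.snoc a w : Fin (n + 1) → ℕ) = Finset.Ico (maxEntry a) w := by
  ext v
  simp only [mem_lowEntries_iff, maxEntry_snoc, admits_snoc_iff,
    Finset.mem_Ico]
  have := fun h => admits_of_maxEntry_le (a := a) (w := v) h
  grind

theorem label_snoc_of_mem {n : ℕ} {a : Fin n → ℕ} {w : ℕ} (ha : a ∈ avoiders n)
    (hw : w ∈ lowEntries a) :
    label (Fin.snoc a w : Fin (n + 1) → ℕ) = ((label a).1 + 1, 1) := by
  have hmax := maxEntry_le_of_isInversionSeq (mem_avoiders_iff.mp ha).1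
  have hlt : w < maxEntry a := (mem_lowEntries_iff.mp hw).1
  simp only [label, maxEntry_snoc, lowEntries_snoc_of_mem hw, Finset.card_singleton,
    max_eq_left hlt.le, Nat.sub_add_comm hmax]

theorem label_snoc_of_maxEntry_le {n : ℕ} {a : Fin n → ℕ} {w : ℕ} (hw : maxEntry a ≤ w) :
    label (Fin.snoc a w : Fin (n + 1) → ℕ) = (n + 1 - w, w - maxEntry a) := by
  simp only [label, maxEntry_snoc, lowEntries_snoc_of_maxEntry_le hw, Nat.card_Ico,
    max_eq_right hw]

/-- The succession rule of the generating tree: `childSum φ l` adds up `φ` over the labels of the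
children of a word with label `l`. -/
def childSum {M : Type*} [AddCommMonoid M] (φ : ℕ × ℕ → M) (l : ℕ × ℕ) : M :=
  l.2 • φ (l.1 + 1, 1) + ∑ j ∈ Finset.range (l.1 + 1), φ (j + 1, l.1 - j)

open Classical in
theorem sum_avoiders_succ {M : Type*} [AddCommMonoid M] {n : ℕ} (f : (Fin (n + 1) → ℕ) → M) :
    ∑ a ∈ avoiders (n + 1), f a =
      ∑ a ∈ avoiders n, ∑ w ∈ (Finset.range (n + 1)).filter (Admits a), f (Fin.snoc a w) := by
  have hmem (a : Fin n → ℕ) (w : ℕ) : (Fin.snoc a w : Fin (n + 1) → ℕ) ∈ avoiders (n + 1) ↔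
      a ∈ avoiders n ∧ w ∈ (Finset.range (n + 1)).filter (Admits a) := by
    rw [snoc_mem_avoiders_iff, Finset.mem_filter, Finset.mem_range, Nat.lt_succ_iff]
  rw [Finset.sum_sigma']
  refine Finset.sum_bij' (fun a _ => ⟨Fin.init a, a (Fin.last n)⟩) (fun x _ => Fin.snoc x.1 x.2)
    (fun a ha => ?_) (fun x hx => ?_) (fun a _ => ?_) (fun x _ => ?_) (fun a _ => ?_)
  · rw [Finset.mem_sigma, ← hmem, Fin.snoc_init_self]
    exact ha
  · exact (hmem _ _).mpr (Finset.mem_sigma.mp hx)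
  all_goals simp

open Classical in
theorem filter_admits_eq_union {n : ℕ} {a : Fin n → ℕ} (ha : maxEntry a ≤ n) :
    (Finset.range (n + 1)).filter (Admits a) =
      lowEntries a ∪ Finset.Ico (maxEntry a) (n + 1) := by
  ext w
  have := fun h => admits_of_maxEntry_le (a := a) (w := w) h
  simp only [mem_lowEntries_iff, Finset.mem_filter, Finset.mem_range, Finset.mem_union,
    Finset.mem_Ico]
  grind

theorem sum_label_avoiders_succ {M : Type*} [AddCommMonoid M] (φ : ℕ × ℕ → M) (n : ℕ) :
    ∑ a ∈ avoiders (n + 1), φ (label a) = ∑ a ∈ avoiders n, childSum φ (label a) := by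
  classical
  rw [sum_avoiders_succ]
  refine Finset.sum_congr rfl fun a ha => ?_
  have hmax := maxEntry_le_of_isInversionSeq (mem_avoiders_iff.mp ha).1
  have hdisj : Disjoint (lowEntries a) (Finset.Ico (maxEntry a) (n + 1)) :=
    Finset.disjoint_left.mpr fun w hw hw' =>
      (mem_lowEntries_iff.mp hw).1.not_ge (Finset.mem_Ico.mp hw').1
  rw [filter_admits_eq_union hmax, Finset.sum_union hdisj, childSum]
  congr 1
  · rw [Finset.sum_congr rfl fun w hw => by rw [label_snoc_of_mem ha hw], Finset.sum_const]
    rfl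
  · rw [Finset.sum_congr rfl fun w hw => by
      rw [label_snoc_of_maxEntry_le (Finset.mem_Ico.mp hw).1], Finset.sum_Ico_eq_sum_range,
      Nat.sub_add_comm hmax, ← Finset.sum_range_reflect]
    refine Finset.sum_congr rfl fun j hj => ?_
    rw [Finset.mem_range] at hj
    simp only [label] at hj ⊢
    congr 2 <;> omega

theorem label_elim0 : label (Fin.elim0 : Fin 0 → ℕ) = (0, 0) := by
  simp [label, lowEntries, maxEntry]

theorem sum_label_avoiders_eq_iterate {M : Type*} [AddCommMonoid M] (φ : ℕ × ℕ → M) (n : ℕ) :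
    ∑ a ∈ avoiders n, φ (label a) = childSum^[n] φ (0, 0) := by
  induction n generalizing φ with
  | zero => simp [avoiders_zero, label_elim0]
  | succ n ih => rw [sum_label_avoiders_succ, ih, Function.iterate_succ_apply]

theorem ncard_relClass (n : ℕ) :
    (relClass noRestriction (· ≠ ·) (· > ·) n).ncard = (avoiders n).card :=
  Set.ncard_eq_toFinset_card _ (relClass_finite n)

theorem coeff_genFun (F : Type*) [Field F] (n : ℕ) :
    PowerSeries.coeff n (genFun F) = ((avoiders n).card : F) := by
  rw [genFun, PowerSeries.coeff_mk, ncard_relClass]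

/-- The number of descendants, `n` generations later, of a word with a given label. It equals
`childSum^[n] 1`, written as a recursion on `n` that evaluates quickly. -/
def descendants : ℕ → ℕ × ℕ → ℕ
  | 0, _ => 1
  | n + 1, (k, c) =>
    c * descendants n (k + 1, 1) + ∑ j ∈ Finset.range (k + 1), descendants n (j + 1, k - j)

theorem descendants_eq_iterate (n : ℕ) : descendants n = childSum^[n] fun _ => 1 := by
  induction n with
  | zero => rfl
  | succ n ih => rw [Function.iterate_succ_apply', ← ih]; rfl

theorem card_avoiders (n : ℕ) : (avoiders n).card = descendants n (0, 0) := by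
  rw [descendants_eq_iterate, ← sum_label_avoiders_eq_iterate, Finset.card_eq_sum_ones]

theorem coeff_genFun_lt_eleven (n : Fin 11) : PowerSeries.coeff (n : ℕ) (genFun ℚ) =
    (![1, 1, 2, 6, 22, 90, 396, 1833, 8801, 43441, 219092] : Fin 11 → ℚ) n := by
  have hterms : ∀ n : Fin 11, descendants n (0, 0) =
      (![1, 1, 2, 6, 22, 90, 396, 1833, 8801, 43441, 219092] : Fin 11 → ℕ) n := by
    decide +kernel
  rw [coeff_genFun, card_avoiders, hterms n]
  fin_cases n <;> simp

section FunctionalEquation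

open PowerSeries

variable {S : Type*} [CommRing S]

/-- The generating series by length of the avoiding words, weighted by a function of the label. -/
noncomputable def labelSeries : (ℕ × ℕ → S) →ₗ[S] S⟦X⟧ where
  toFun φ := PowerSeries.mk fun n => ∑ a ∈ avoiders n, φ (label a)
  map_add' φ ψ := by ext n; simp [Finset.sum_add_distrib]
  map_smul' s φ := by ext n; simp [Finset.mul_sum]

theorem labelSeries_eq_add_X_mul (φ : ℕ × ℕ → S) :
    labelSeries φ = C (φ (0, 0)) + X * labelSeries (childSum φ) := by
  ext n
  cases n with
  | zero => simp [labelSeries, avoiders_zero, label_elim0]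
  | succ n => simp [labelSeries, sum_label_avoiders_succ, coeff_succ_X_mul]

theorem labelSeries_one (F : Type*) [Field F] : labelSeries (1 : ℕ × ℕ → F) = genFun F := by
  ext n
  simp [labelSeries, coeff_genFun]

theorem map_labelSeries {S' : Type*} [CommRing S'] (f : S →+* S') (φ : ℕ × ℕ → S) :
    PowerSeries.map f (labelSeries φ) = labelSeries (f ∘ φ) := by
  ext n
  simp [labelSeries]

theorem sub_one_smul_childSum_pow (x : S) :
    (x - 1) • childSum (fun l => x ^ l.1) =
      ((x - 1) * x) • (fun l => (l.2 : S) * x ^ l.1) + x ^ 2 • (fun l => x ^ l.1)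
        - x • (1 : ℕ × ℕ → S) := by
  ext ⟨k, c⟩
  have hgeom := mul_geom_sum x (k + 1)
  simp only [childSum, pow_succ' x, ← Finset.mul_sum, nsmul_eq_mul, Pi.add_apply, Pi.sub_apply,
    Pi.smul_apply, Pi.one_apply, smul_eq_mul] at hgeom ⊢
  linear_combination x * hgeom

theorem sub_one_sq_mul_sum_sub_mul_pow (x : S) (k : ℕ) :
    (x - 1) ^ 2 * ∑ j ∈ Finset.range (k + 1), ((k - j : ℕ) : S) * x ^ j =
      x * x ^ k - (x - 1) * k - x := by
  induction k with
  | zero => simp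
  | succ k ih =>
    have hgeom := mul_geom_sum x (k + 1)
    have hsplit : ∑ j ∈ Finset.range (k + 1), ((k + 1 - j : ℕ) : S) * x ^ j =
        ∑ j ∈ Finset.range (k + 1), ((k - j : ℕ) : S) * x ^ j +
          ∑ j ∈ Finset.range (k + 1), x ^ j := by
      rw [← Finset.sum_add_distrib]
      refine Finset.sum_congr rfl fun j hj => ?_
      rw [Nat.sub_add_comm (Finset.mem_range_succ_iff.mp hj), Nat.cast_succ, add_one_mul]
    rw [Finset.sum_range_succ, hsplit, Nat.sub_self, Nat.cast_zero, zero_mul, add_zero, mul_add, ih]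
    push_cast
    linear_combination (x - 1) * hgeom

theorem sub_one_sq_smul_childSum_mul_pow (x : S) :
    (x - 1) ^ 2 • childSum (fun l => (l.2 : S) * x ^ l.1) =
      ((x - 1) ^ 2 * x) • (fun l => (l.2 : S) * x ^ l.1) + x ^ 2 • (fun l => x ^ l.1)
        - (x * (x - 1)) • (fun l => (l.1 : S)) - x ^ 2 • (1 : ℕ × ℕ → S) := by
  ext ⟨k, c⟩
  have hsum := sub_one_sq_mul_sum_sub_mul_pow x k
  simp only [childSum, pow_succ' x, mul_left_comm _ x, ← Finset.mul_sum, nsmul_eq_mul,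
    Nat.cast_one, one_mul, Pi.add_apply, Pi.sub_apply, Pi.smul_apply, Pi.one_apply,
    smul_eq_mul] at hsum ⊢
  linear_combination x * hsum

/-- The polynomial in `x` proportional to `K(z, 1/(zx))`; it is the kernel of the functional
equation of the generating tree. -/
def reciprocalKernel {R : Type*} [CommRing R] (z x : R) : R :=
  z ^ 2 * x ^ 4 - (2 * z ^ 2 + 2 * z) * x ^ 3 + (3 * z + 1) * x ^ 2 - (z + 2) * x + 1

theorem labelSeries_pow_mul_reciprocalKernel (x : S) :
    labelSeries (fun l => x ^ l.1) * reciprocalKernel X (C x) =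
      (C x - 1) ^ 2 * (1 - X * C x)
        - X * C x * (1 - X * C x) * (C x - 1) * labelSeries 1
        - X ^ 2 * C x ^ 2 * ((C x - 1) * labelSeries (fun l => (l.1 : S))
          + C x * labelSeries 1) := by
  have hsite : (C x - 1) * labelSeries (childSum fun l => x ^ l.1) =
      (C x - 1) * C x * labelSeries (fun l => l.2 * x ^ l.1)
        + C x ^ 2 * labelSeries (fun l => x ^ l.1) - C x * labelSeries 1 := by
    simpa [smul_eq_C_mul] using congrArg labelSeries (sub_one_smul_childSum_pow x)
  have hlow : (C x - 1) ^ 2 * labelSeries (childSum fun l => (l.2 : S) * x ^ l.1) =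
      (C x - 1) ^ 2 * C x * labelSeries (fun l => l.2 * x ^ l.1)
        + C x ^ 2 * labelSeries (fun l => x ^ l.1)
        - C x * (C x - 1) * labelSeries (fun l => (l.1 : S)) - C x ^ 2 * labelSeries 1 := by
    simpa [smul_eq_C_mul] using congrArg labelSeries (sub_one_sq_smul_childSum_mul_pow x)
  have hT := labelSeries_eq_add_X_mul fun l : ℕ × ℕ => x ^ l.1
  have hB := labelSeries_eq_add_X_mul fun l : ℕ × ℕ => (l.2 : S) * x ^ l.1
  simp only [pow_zero, map_one, Nat.cast_zero, zero_mul, map_zero, zero_add] at hT hB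
  rw [reciprocalKernel]
  linear_combination (C x - 1) ^ 2 * (1 - X * C x) * hT + X * (C x - 1) * (1 - X * C x) * hsite
    + X * C x * (C x - 1) ^ 2 * hB + X ^ 2 * C x * hlow

end FunctionalEquation

section KernelMethod

open Polynomial
open scoped PowerSeries

variable {R : Type*} [CommRing R]

/-- The embedding of `R⟦z⟧[x]` into `R[x]⟦z⟧`. -/
noncomputable def polyToSeries : R⟦X⟧[X] →+* R[X]⟦X⟧ :=
  eval₂RingHom (PowerSeries.map C) (PowerSeries.C X)

theorem polyToSeries_C (f : R⟦X⟧) : polyToSeries (C f) = PowerSeries.map C f :=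
  eval₂_C _ _

theorem polyToSeries_X : polyToSeries (X : R⟦X⟧[X]) = PowerSeries.C X :=
  eval₂_X _ _

theorem coeff_coeff_polyToSeries (f : R⟦X⟧[X]) (n i : ℕ) :
    (PowerSeries.coeff n (polyToSeries f)).coeff i = PowerSeries.coeff n (f.coeff i) := by
  induction f using Polynomial.induction_on' with
  | add f g hf hg => simp [hf, hg]
  | monomial j a =>
    rw [polyToSeries, coe_eval₂RingHom, eval₂_monomial, ← map_pow, PowerSeries.coeff_mul_C,
      PowerSeries.coeff_map, Polynomial.coeff_C_mul_X_pow, Polynomial.coeff_monomial]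
    split_ifs <;> simp_all

theorem map_eval_polyToSeries (r : R) (f : R⟦X⟧[X]) :
    PowerSeries.map (evalRingHom r) (polyToSeries f) = f.eval (PowerSeries.C r) := by
  have h : (PowerSeries.map (evalRingHom r)).comp polyToSeries =
      evalRingHom (PowerSeries.C r : R⟦X⟧) := by
    ext <;> simp [polyToSeries]
  exact congrArg (· f) h

theorem coeff_zero_polyToSeries (f : R⟦X⟧[X]) :
    PowerSeries.coeff 0 (polyToSeries f) = f.map PowerSeries.constantCoeff := by
  ext i
  rw [coeff_coeff_polyToSeries, Polynomial.coeff_map, PowerSeries.coeff_zero_eq_constantCoeff_apply]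

theorem degree_coeff_polyToSeries_le (f : R⟦X⟧[X]) (n : ℕ) :
    (PowerSeries.coeff n (polyToSeries f)).degree ≤ f.degree :=
  degree_le_iff_coeff_zero _ _ |>.mpr fun i hi => by
    rw [coeff_coeff_polyToSeries, coeff_eq_zero_of_degree_lt hi, map_zero]

-- The first nonzero coefficient of `W`, times the monic polynomial `Q` at `z = 0`, would be a
-- coefficient of `r`, whose degree is too small.
theorem eq_zero_of_mul_polyToSeries_eq {Q r : R⟦X⟧[X]} (hQ : Q.Monic) (hr : r.degree < Q.degree)
    {W : R[X]⟦X⟧} (hW : W * polyToSeries Q = polyToSeries r) : W = 0 := by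
  nontriviality R
  have hQ₀ : (PowerSeries.coeff 0 (polyToSeries Q)).Monic := by
    rw [coeff_zero_polyToSeries]
    exact hQ.map _
  ext1 n
  induction n using Nat.strong_induction_on with | _ n ih =>
  have hcoeff : PowerSeries.coeff n W * PowerSeries.coeff 0 (polyToSeries Q) =
      PowerSeries.coeff n (polyToSeries r) := by
    rw [← hW, PowerSeries.coeff_mul, Finset.sum_eq_single_of_mem (n, 0) (by simp)]
    rintro ⟨i, j⟩ hij hne
    rw [Finset.HasAntidiagonal.mem_antidiagonal] at hij
    rw [ih i (by grind), map_zero, zero_mul]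
  have hdeg : (PowerSeries.coeff 0 (polyToSeries Q)).degree = Q.degree := by
    rw [coeff_zero_polyToSeries, hQ.degree_map]
  by_contra hne
  refine hQ₀.not_dvd_of_degree_lt ?_ ?_ (Dvd.intro_left _ hcoeff)
  · rw [← hcoeff]
    exact hQ₀.mul_left_ne_zero hne
  · rw [hdeg]
    exact (degree_coeff_polyToSeries_le r n).trans_lt hr

theorem polyToSeries_injective : Function.Injective (polyToSeries (R := R)) := fun f g h => by
  ext i n
  rw [← coeff_coeff_polyToSeries, h, coeff_coeff_polyToSeries]

theorem exists_polyToSeries_eq_of_mul_eq {Q G : R⟦X⟧[X]} (hQ : Q.Monic) {T : R[X]⟦X⟧}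
    (hT : T * polyToSeries Q = polyToSeries G) :
    ∃ S, T = polyToSeries S ∧ G = S * Q := by
  nontriviality R
  have hdiv := modByMonic_add_div G Q
  have hmod : (T - polyToSeries (G /ₘ Q)) * polyToSeries Q = polyToSeries (G %ₘ Q) := by
    rw [sub_mul, hT, ← map_mul, ← map_sub, mul_comm, ← eq_sub_of_add_eq hdiv]
  have hzero := eq_zero_of_mul_polyToSeries_eq hQ (degree_modByMonic_lt G hQ) hmod
  rw [hzero, zero_mul] at hmod
  have hrem : G %ₘ Q = 0 := polyToSeries_injective (hmod.symm.trans (map_zero _).symm)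
  refine ⟨G /ₘ Q, sub_eq_zero.mp hzero, ?_⟩
  rw [hrem, zero_add] at hdiv
  rw [mul_comm, hdiv]

/-- The relations between the sum `s` and the product `p` of two distinct roots of the kernel, the
other two roots being eliminated. -/
structure VietaRelations (z s p : R) : Prop where
  coeff_two : 1 + s * p * (z ^ 2 + 2 * z - s * z ^ 2) + p ^ 2 * z ^ 2 = (3 * z + 1) * p
  coeff_one : s + p ^ 2 * (z ^ 2 + 2 * z - s * z ^ 2) = (2 * z + 2) * p

theorem VietaRelations.mul_reciprocalKernel {z s p : R} (h : VietaRelations z s p) (x : R) :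
    p * reciprocalKernel z x =
      (1 - s * z * x + p * z ^ 2 * x ^ 2) * (x ^ 2 - p * (z + 2 - z * s) * x + p) := by
  unfold reciprocalKernel
  linear_combination (- x ^ 2) * h.coeff_two + z * x ^ 3 * h.coeff_one

theorem VietaRelations.map {z s p : R} {R' : Type*} [CommRing R'] (f : R →+* R')
    (h : VietaRelations z s p) : VietaRelations (f z) (f s) (f p) where
  coeff_two := by simpa [map_ofNat f] using congrArg f h.coeff_two
  coeff_one := by simpa [map_ofNat f] using congrArg f h.coeff_one

theorem map_reciprocalKernel {R' : Type*} [CommRing R'] (f : R →+* R') (z x : R) :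
    f (reciprocalKernel z x) = reciprocalKernel (f z) (f x) := by
  simp [reciprocalKernel, map_ofNat f]

theorem VietaRelations.C_mul_reciprocalKernel {z s p : R} (h : VietaRelations z s p) :
    C p * reciprocalKernel (C z) X =
      (1 - C (s * z) * X + C (p * z ^ 2) * X ^ 2) *
        (X ^ 2 - C (p * (z + 2 - z * s)) * X + C p) := by
  rw [(h.map C).mul_reciprocalKernel, ← map_ofNat C 2]
  simp only [map_add, map_sub, map_mul, map_pow]

theorem eq_C_mul_X_add_C_of_C_mul_eq_mul [IsDomain R] {p b : R} (hp : p ≠ 0) {G S : R[X]}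
    (hG : G.natDegree ≤ 3) (h : C p * G = S * (X ^ 2 - C (p * b) * X + C p)) :
    S = C (G.coeff 1 + b * G.coeff 0) * X + C (G.coeff 0) := by
  have hQ : (X ^ 2 - C (p * b) * X + C p).Monic := by monicity!
  have hQdeg : (X ^ 2 - C (p * b) * X + C p).natDegree = 2 := by compute_degree!
  have hS : S.natDegree ≤ 1 := by
    rcases eq_or_ne S 0 with rfl | hS
    · simp
    have hdeg := (natDegree_C_mul_le p G).trans hG
    rw [h, mul_comm, hQ.natDegree_mul' hS, hQdeg] at hdeg
    omega
  obtain ⟨c, d, rfl⟩ : ∃ c d, S = C c * X + C d := ⟨_, _, eq_X_add_C_of_natDegree_le_one hS⟩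
  have hexpand : (C c * X + C d) * (X ^ 2 - C (p * b) * X + C p) =
      C c * X ^ 3 + C (d - c * (p * b)) * X ^ 2 + C (c * p - d * (p * b)) * X ^ 1 + C (d * p) := by
    simp only [map_sub, map_mul]
    ring
  have hcoeff (n : ℕ) := congrArg (coeff · n) (h.trans hexpand)
  simp only [coeff_add, coeff_C_mul, coeff_X_pow, coeff_C] at hcoeff
  have hd : d = G.coeff 0 := mul_left_cancel₀ hp (by simpa [mul_comm] using (hcoeff 0).symm)
  have hcd : c * p - d * (p * b) = p * G.coeff 1 := by simpa using (hcoeff 1).symm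
  have hc : c = G.coeff 1 + b * G.coeff 0 :=
    mul_left_cancel₀ hp (by linear_combination hcd + p * b * hd)
  rw [hc, hd]

theorem map_eval_mul_eq_of_mul_reciprocalKernel_eq [IsDomain R] {z s p : R⟦X⟧} (hp : p ≠ 0)
    (hV : VietaRelations z s p) {T : R[X]⟦X⟧} {G : R⟦X⟧[X]} (hG : G.natDegree ≤ 3)
    (hT : T * polyToSeries (reciprocalKernel (C z) X) = polyToSeries G) (r : R) :
    PowerSeries.map (evalRingHom r) T *
        (1 - s * z * PowerSeries.C r + p * z ^ 2 * PowerSeries.C r ^ 2) =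
      (G.coeff 1 + (z + 2 - z * s) * G.coeff 0) * PowerSeries.C r + G.coeff 0 := by
  obtain ⟨S, hTS, hGS⟩ := exists_polyToSeries_eq_of_mul_eq
    (T := T * polyToSeries (1 - C (s * z) * X + C (p * z ^ 2) * X ^ 2)) (G := C p * G)
    (Q := X ^ 2 - C (p * (z + 2 - z * s)) * X + C p) (by monicity!) (by
      rw [mul_assoc, ← map_mul, ← hV.C_mul_reciprocalKernel, map_mul, map_mul, ← hT]
      ring)
  rw [eq_C_mul_X_add_C_of_C_mul_eq_mul hp hG hGS] at hTS
  simpa only [map_mul, map_eval_polyToSeries, eval_add, eval_sub, eval_mul, eval_pow, eval_one,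
    eval_C, eval_X] using congrArg (PowerSeries.map (evalRingHom r)) hTS

end KernelMethod

section GeneratingFunction

open Polynomial
open scoped PowerSeries

/-- The right-hand side of the functional equation of `labelSeries`, as a polynomial in the
catalytic variable; `a` and `m` stand for the generating function and for the generating series
weighted by the first component of the label. -/
noncomputable def catalyticSide {R : Type*} [CommRing R] (z a m : R) : R[X] :=
  (X - 1) ^ 2 * (1 - C z * X) - C z * X * (1 - C z * X) * (X - 1) * C a -
    C z ^ 2 * X ^ 2 * ((X - 1) * C m + X * C a)

section CatalyticSide

variable {R : Type*} [CommRing R] (z a m : R)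

theorem catalyticSide_eq : catalyticSide z a m =
    C (-(z ^ 2 * m) - z) * X ^ 3 +
      C (1 + 2 * z - z * a - z ^ 2 * a + z ^ 2 * m) * X ^ 2 + C (z * a - z - 2) * X + C 1 := by
  simp only [catalyticSide, map_add, map_sub, map_mul, map_pow, map_neg, map_one, map_ofNat]
  ring

theorem natDegree_catalyticSide_le : (catalyticSide z a m).natDegree ≤ 3 := by
  rw [catalyticSide_eq]
  compute_degree

theorem coeff_zero_catalyticSide : (catalyticSide z a m).coeff 0 = 1 := by
  simp [catalyticSide_eq]

theorem coeff_one_catalyticSide : (catalyticSide z a m).coeff 1 = z * a - z - 2 := by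
  rw [catalyticSide_eq]
  simp only [coeff_add, coeff_C_mul, coeff_X_pow, coeff_X, coeff_C]
  simp

theorem map_catalyticSide {R' : Type*} [CommRing R'] (f : R →+* R') :
    (catalyticSide z a m).map f = catalyticSide (f z) (f a) (f m) := by
  simp [catalyticSide]

end CatalyticSide

variable {F : Type*} [Field F]

theorem labelSeries_mul_polyToSeries_reciprocalKernel :
    labelSeries (fun l => (X : F[X]) ^ l.1) *
        polyToSeries (reciprocalKernel (C (PowerSeries.X : F⟦X⟧)) X) =
      polyToSeries (catalyticSide PowerSeries.X (genFun F) (labelSeries fun l => (l.1 : F))) := by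
  have hA : PowerSeries.map C (genFun F) = labelSeries 1 := by
    rw [← labelSeries_one, map_labelSeries]
    simp [Function.comp_def, Pi.one_def]
  have hM : PowerSeries.map C (labelSeries fun l => (l.1 : F)) =
      labelSeries fun l => (l.1 : F[X]) := by
    rw [map_labelSeries]
    simp [Function.comp_def]
  have hX : PowerSeries.map C (PowerSeries.X : F⟦X⟧) = PowerSeries.X := PowerSeries.map_X _
  rw [map_reciprocalKernel]
  simp only [catalyticSide, map_add, map_sub, map_mul, map_pow, map_one, polyToSeries_C,
    polyToSeries_X, hA, hM, hX]
  exact labelSeries_pow_mul_reciprocalKernel (X : F[X])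

theorem polyToSeries_map_expand {m : ℕ} (hm : m ≠ 0) (f : F⟦X⟧[X]) :
    polyToSeries (f.map (RingHomClass.toRingHom (PowerSeries.expand m hm (R := F)))) =
      PowerSeries.expand m hm (polyToSeries f) := by
  have h : polyToSeries.comp
      (mapRingHom (RingHomClass.toRingHom (PowerSeries.expand m hm (R := F)))) =
      (RingHomClass.toRingHom (PowerSeries.expand m hm (R := F[X]))).comp polyToSeries := by
    ext a <;> simp [polyToSeries_C, polyToSeries_X, PowerSeries.map_expand, PowerSeries.expand_C]
  exact congrArg (· f) h

theorem expand_genFun_mul_eq {m : ℕ} (hm : m ≠ 0) {s p : F⟦X⟧} (hp : p ≠ 0)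
    (hV : VietaRelations (PowerSeries.X ^ m) s p) :
    PowerSeries.expand m hm (genFun F) *
        (1 - s * PowerSeries.X ^ m - PowerSeries.X ^ m + p * (PowerSeries.X ^ m) ^ 2) =
      1 - s * PowerSeries.X ^ m := by
  have hT := congrArg (PowerSeries.expand m hm)
    (labelSeries_mul_polyToSeries_reciprocalKernel (F := F))
  rw [map_mul, ← polyToSeries_map_expand, ← polyToSeries_map_expand, map_catalyticSide,
    ← coe_mapRingHom, map_reciprocalKernel, coe_mapRingHom, map_C, map_X] at hT
  simp only [RingHom.coe_coe, PowerSeries.expand_X] at hT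
  have hA : PowerSeries.map (evalRingHom 1) (PowerSeries.expand m hm
      (labelSeries fun l => (X : F[X]) ^ l.1)) = PowerSeries.expand m hm (genFun F) := by
    rw [PowerSeries.map_expand, map_labelSeries, ← labelSeries_one]
    simp [Function.comp_def, Pi.one_def]
  have h := map_eval_mul_eq_of_mul_reciprocalKernel_eq hp hV (natDegree_catalyticSide_le _ _ _) hT 1
  rw [coeff_zero_catalyticSide, coeff_one_catalyticSide, hA, map_one] at h
  linear_combination h

end GeneratingFunction

section Elimination

variable {R : Type*} [CommRing R] {z s p a y q : R}

theorem VietaRelations.mul_sq_eq (h : VietaRelations z s p) :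
    z * (1 - p * z) ^ 2 = (1 - (1 - p * z)) * (1 - s * z) * (1 - s * z + z) := by
  linear_combination z * h.coeff_two

theorem VietaRelations.sq_add_eq (h : VietaRelations z s p) :
    (1 - p * z) ^ 2 + (1 - s * z + z) * (1 - (1 - p * z)) ^ 2 =
      1 - s * z + 2 * z * (1 - (1 - p * z)) := by
  linear_combination z * h.coeff_one

theorem VietaRelations.mul_eq_of_mul_eq [IsDomain R] (h : VietaRelations z s p) (hz : z ≠ 0)
    (hden : 1 - s * z - z + p * z ^ 2 ≠ 0) (ha : a * (1 - s * z - z + p * z ^ 2) = 1 - s * z) :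
    a * (p * z * (p * z - s * z + z + 1)) = (p - s + 1) * (z * p - 1) := by
  refine mul_left_cancel₀ (mul_ne_zero hden hz) ?_
  have hcross : (1 - p * z) * (s * z - p * z - z) * (1 - s * z - z + p * z ^ 2) =
      (1 - s * z) * z * (p * z) * (p * z - s * z + z + 1) := by
    linear_combination
      (p * z + z - 1) * h.mul_sq_eq + (1 - s * z) * h.sq_add_eq
  linear_combination z * (p * z * (p * z - s * z + z + 1)) * ha - hcross

/-- The sextic polynomial in `a`, with coefficients depending on `z`, of which the generating
function is a root. -/
def sextic (z a : R) : R :=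
  (3 * z ^ 3 + z) * a ^ 6 - (2 * z ^ 3 + 6 * z ^ 2 + 3 * z + 1) * a ^ 5
    + (11 * z ^ 2 + 5 * z + 5) * a ^ 4 - (5 * z ^ 2 + 7 * z + 10) * a ^ 3
    + (6 * z + 10) * a ^ 2 - (2 * z + 5) * a + 1

theorem map_sextic {R' : Type*} [CommRing R'] (f : R →+* R') (z a : R) :
    f (sextic z a) = sextic (f z) (f a) := by
  simp [sextic, map_ofNat f]

-- Eliminating `y` with the help of `a * (y - z * q) = y` leaves a cubic and a quadratic equation
-- for `q`, from which `q` is eliminated by descending the degree.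
theorem sextic_eq_zero_of_mul_eq [IsDomain R] (hz : z ≠ 0) (hq : q ≠ 0)
    (ha : a * (y - z * q) = y) (h₁ : z * q ^ 2 = (1 - q) * y * (y + z))
    (h₂ : q ^ 2 + (y + z) * (1 - q) ^ 2 = y + 2 * z * (1 - q)) : sextic z a = 0 := by
  obtain ⟨b, rfl⟩ : ∃ b, a = b + 1 := ⟨a - 1, by ring⟩
  have hy : b * y = (b + 1) * z * q := by linear_combination ha
  have hquad₁ : (b + 1) ^ 2 * z * q ^ 2 - ((b + 1) * z - b ^ 2) * q - b * (b + 1) * z = 0 := by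
    refine mul_left_cancel₀ (mul_ne_zero hz hq) ?_
    linear_combination b ^ 2 * h₁ + (1 - q) * (b * y + b * z + (b + 1) * z * q) * hy
  have hcubic : b * q ^ 2 + (1 - q) ^ 2 * (b * z + (b + 1) * z * q) - (b + 1) * z * q -
      2 * b * z * (1 - q) = 0 := by
    linear_combination b * h₂ - ((1 - q) ^ 2 - 1) * hy
  have hquad₂ : b * q ^ 2 + q * (b ^ 2 + (b - 1) * (b + 1) * z) - 2 * b * (b + 1) * z = 0 := by
    linear_combination (b + 1) * hcubic - q * hquad₁ + hquad₁
  have hlin₁ : q * ((b + 1) ^ 2 * b ^ 2 * z + (b - 1) * (b + 1) ^ 3 * z ^ 2 + b * (b + 1) * z -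
      b ^ 3) = b * (b + 1) * z * (2 * (b + 1) ^ 2 * z - b) := by
    linear_combination (b + 1) ^ 2 * z * hquad₂ - b * hquad₁
  have hlin₂ : (2 * (b + 1) ^ 2 * z - b) * q = (b + 1) ^ 2 * z - b ^ 2 := by
    refine mul_left_cancel₀ hq ?_
    linear_combination 2 * hquad₁ - hquad₂
  unfold sextic
  linear_combination (-(2 * (b + 1) ^ 2 * z - b)) * hlin₁ +
    ((b + 1) ^ 2 * b ^ 2 * z + (b - 1) * (b + 1) ^ 3 * z ^ 2 + b * (b + 1) * z - b ^ 3) * hlin₂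

theorem VietaRelations.sextic_eq_zero [IsDomain R] (h : VietaRelations z s p) (hz : z ≠ 0)
    (hpz : 1 - p * z ≠ 0) (ha : a * (1 - s * z - z + p * z ^ 2) = 1 - s * z) : sextic z a = 0 :=
  sextic_eq_zero_of_mul_eq hz hpz (by linear_combination ha) h.mul_sq_eq h.sq_add_eq

section Roots

variable [IsDomain R] {x : R}

theorem ne_zero_of_kernel_eq_zero (h : kernel z x = 0) : x ≠ 0 := by
  rintro rfl
  simp [kernel] at h

theorem vietaRelations_of_kernel_eq_zero (hx : kernel z x = 0) (hy : kernel z y = 0)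
    (hxy : x ≠ y) : VietaRelations z (x + y) (x * y) := by
  have hx₀ := ne_zero_of_kernel_eq_zero hx
  have hy₀ := ne_zero_of_kernel_eq_zero hy
  unfold kernel at hx hy
  have h₂ : 1 + (x + y) * (x * y) * (z ^ 2 + 2 * z - (x + y) * z ^ 2) + (x * y) ^ 2 * z ^ 2 =
      (3 * z + 1) * (x * y) := by
    refine mul_left_cancel₀ (mul_ne_zero (mul_ne_zero hx₀ hy₀) (sub_ne_zero.mpr hxy)) ?_
    linear_combination (-(x * y * y)) * hx + x * y * x * hy
  refine ⟨h₂, mul_left_cancel₀ hx₀ ?_⟩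
  linear_combination x * y * hx + x ^ 2 * h₂

end Roots

theorem VietaRelations.mul_kernel (h : VietaRelations z s p) (t : R) :
    p * kernel z t =
      (t ^ 2 - s * t + p) * (1 + z * (p * z * t ^ 2 - p * (z + 2 - s * z) * t)) := by
  unfold kernel
  linear_combination t * h.coeff_one - t ^ 2 * h.coeff_two

theorem map_kernel {R' : Type*} [CommRing R'] (f : R →+* R') (z x : R) :
    f (kernel z x) = kernel (f z) (f x) := by
  simp [kernel, map_ofNat f]

end Elimination

section Hensel

open Polynomial

variable {R : Type*} [CommRing R] {I : Ideal R} [HenselianRing R I]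

-- Reversing `f` makes it monic; the reversed polynomial is congruent to `X ^ n * (X + C b)`, of
-- which `-b` is a simple root.
theorem exists_isRoot_of_map_eq {b : R} (hb : IsUnit b) {f : R[X]} (hf₀ : f.coeff 0 = 1)
    (hf : f.map (Ideal.Quotient.mk I) = 1 + C (Ideal.Quotient.mk I b) * X) :
    ∃ u, f.IsRoot u := by
  set n := f.natDegree with hn
  set g := reflect (n + 1) f with hg
  have hmonic : g.Monic := by
    refine monic_of_natDegree_le_of_coeff_eq_one (n + 1) ?_ ?_
    · exact natDegree_reflect_le.trans (by simp [hn])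
    · simp [hg, coeff_reflect, hf₀]
  have hmap : g.map (Ideal.Quotient.mk I) = X ^ n * (X + C (Ideal.Quotient.mk I b)) := by
    have hX : reflect (n + 1) (X : (R ⧸ I)[X]) = X ^ n := by
      simpa using reflect_monomial (R := R ⧸ I) (n + 1) 1
    rw [hg, ← reflect_map, hf, reflect_add, reflect_one, reflect_C_mul, hX]
    ring
  obtain ⟨v, hv, hvb⟩ := HenselianRing.is_henselian (I := I) g hmonic (-b)
    (by rw [← Ideal.Quotient.eq_zero_iff_mem, ← eval_map_apply, hmap]; simp)
    (by
      rw [← eval_map_apply, ← derivative_map, hmap]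
      simpa using ((hb.neg.map (Ideal.Quotient.mk I)).pow n))
  have := isLocalHom_of_le_jacobson_bot I HenselianRing.jac
  obtain ⟨v, rfl⟩ : IsUnit v := IsUnit.of_map (Ideal.Quotient.mk I) v <| by
    rw [Ideal.Quotient.eq.mpr hvb]
    exact hb.neg.map _
  let := v⁻¹.invertible
  refine ⟨↑v⁻¹, (eval₂_reflect_eq_zero_iff (RingHom.id R) (↑v⁻¹ : R) (n + 1) f
    (by simp [hn])).mp ?_⟩
  simpa using hv

theorem exists_isRoot_dvd_sub (f : R[X]) {a : R} (ha : f.eval a ∈ I)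
    (hderiv : IsUnit (f.derivative.eval a)) : ∃ x, f.IsRoot x ∧ f.eval a ∣ x - a := by
  set c := f.eval a
  set b := f.derivative.eval a
  obtain ⟨g, hg⟩ : ∃ g, taylor a f = C c + C b * X + X ^ 2 * g := by
    refine ⟨(taylor a f).divX.divX, ?_⟩
    have h₁ := divX_mul_X_add (taylor a f)
    have h₂ := divX_mul_X_add (taylor a f).divX
    rw [taylor_coeff_zero] at h₁
    rw [coeff_divX, zero_add, taylor_coeff_one] at h₂
    linear_combination -(X * h₂) - h₁
  obtain ⟨u, hu⟩ := exists_isRoot_of_map_eq (I := I)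
    (f := 1 + C b * X + C c * X ^ 2 * g.comp (C c * X)) hderiv (by simp)
    (by simp [Ideal.Quotient.eq_zero_iff_mem.mpr ha])
  refine ⟨c * u + a, ?_, by simp⟩
  have hroot : f.eval (c * u + a) = (taylor a f).eval (c * u) := by simp [taylor_apply]
  simp only [IsRoot, eval_add, eval_one, eval_mul, eval_C, eval_X, eval_pow, eval_comp] at hu
  rw [IsRoot, hroot, hg]
  simp only [eval_add, eval_mul, eval_C, eval_X, eval_pow]
  linear_combination c * hu

end Hensel

section Roots

open PowerSeries

/-- The kernel at `z = w ^ 2`, after the substitution `x = 1 + w * (y / 2)`, multiplied by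
`16 / w ^ 2`. It separates the two roots that meet in `x = 1`: modulo `w`, it is
`4 * y ^ 2 - 16`. -/
noncomputable def separatedKernel {R : Type*} [CommRing R] (w : R) : Polynomial R :=
  .C (w ^ 6) * .X ^ 4 + .C (2 * (3 * w ^ 5 - 2 * w ^ 3)) * .X ^ 3 +
    .C (4 * (3 * w ^ 4 - 3 * w ^ 2 + 1)) * .X ^ 2 + .C (8 * (w ^ 3 - 2 * w)) * .X - .C 16

theorem eval_separatedKernel {R : Type*} [CommRing R] (w y : R) :
    (separatedKernel w).eval y = w ^ 6 * y ^ 4 + 2 * (3 * w ^ 5 - 2 * w ^ 3) * y ^ 3 +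
      4 * (3 * w ^ 4 - 3 * w ^ 2 + 1) * y ^ 2 + 8 * (w ^ 3 - 2 * w) * y - 16 := by
  simp only [separatedKernel, Polynomial.eval_add, Polynomial.eval_sub, Polynomial.eval_mul,
    Polynomial.eval_pow, Polynomial.eval_C, Polynomial.eval_X]

theorem sixteen_mul_kernel {R : Type*} [CommRing R] (w y : R) :
    16 * kernel (w ^ 2) (1 + w * y) = w ^ 2 * (separatedKernel w).eval (2 * y) := by
  rw [eval_separatedKernel, kernel]
  ring

variable {F : Type*} [Field F] [CharZero F]

theorem exists_isRoot_separatedKernel : ∃ y : F⟦X⟧, (separatedKernel X).IsRoot y ∧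
    X ^ 6 ∣ y - (2 + 2 * X + 4 * X ^ 2 + 7 * X ^ 3 + 13 * X ^ 4 + 26 * X ^ 5) := by
  set a : F⟦X⟧ := 2 + 2 * X + 4 * X ^ 2 + 7 * X ^ 3 + 13 * X ^ 4 + 26 * X ^ 5 with ha
  have hdvd : X ^ 6 ∣ (separatedKernel X).eval a := by
    rw [eval_separatedKernel, ha]
    exact ⟨-836 - 1728 * X - 2800 * X ^ 2 - 4344 * X ^ 3 - 7520 * X ^ 4 - 12852 * X ^ 5 -
      11172 * X ^ 6 + 7096 * X ^ 7 + 44786 * X ^ 8 + 93350 * X ^ 9 + 173874 * X ^ 10 +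
      310182 * X ^ 11 + 514237 * X ^ 12 + 773916 * X ^ 13 + 947934 * X ^ 14 + 1049828 * X ^ 15 +
      1158833 * X ^ 16 + 1247896 * X ^ 17 + 1177592 * X ^ 18 + 913952 * X ^ 19 + 456976 * X ^ 20,
      by ring⟩
  have hderiv : IsUnit ((separatedKernel X).derivative.eval a) := by
    rw [isUnit_iff_constantCoeff, isUnit_iff_ne_zero]
    simp only [separatedKernel, Polynomial.derivative_add, Polynomial.derivative_sub,
      Polynomial.derivative_C_mul, Polynomial.derivative_X_pow, Polynomial.derivative_X,
      Polynomial.derivative_C]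
    simp [ha, map_ofNat (constantCoeff (R := F))]
  obtain ⟨y, hy, hya⟩ := exists_isRoot_dvd_sub (I := Ideal.span {X}) _
    (Ideal.mem_span_singleton.mpr ((dvd_pow_self X (by norm_num)).trans hdvd)) hderiv
  exact ⟨y, hy, hdvd.trans hya⟩

theorem exists_kernel_X_sq_eq_zero (F : Type*) [Field F] [CharZero F] :
    ∃ x : F⟦X⟧, kernel (X ^ 2) x = 0 ∧
      ∀ k : Fin 7, coeff k x = (![1, 1, 1, 2, 7 / 2, 13 / 2, 13] : Fin 7 → F) k := by
  obtain ⟨y, hy, t, ht⟩ := exists_isRoot_separatedKernel (F := F)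
  have htwo : 2 * (C (1 / 2) : F⟦X⟧) = 1 := by
    rw [← map_ofNat C 2, ← map_mul]
    norm_num
  refine ⟨1 + X * (C (1 / 2) * y), ?_, fun k => ?_⟩
  · have h := sixteen_mul_kernel X (C (1 / 2) * y)
    rw [← mul_assoc 2, htwo, one_mul, hy, mul_zero] at h
    refine (mul_eq_zero.mp h).resolve_left ?_
    rw [← map_ofNat C 16, map_eq_zero_iff _ C_injective]
    norm_num
  · have hx : 1 + X * (C (1 / 2) * y) = C 1 + C 1 * X ^ 1 + C 1 * X ^ 2 + C 2 * X ^ 3 +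
        C (7 / 2) * X ^ 4 + C (13 / 2) * X ^ 5 + C 13 * X ^ 6 + X ^ 7 * (C (1 / 2) * t) := by
      have hdiv (n : F) : C (n / 2) = C (1 / 2) * C n := by
        rw [← map_mul]
        ring_nf
      simp only [eq_add_of_sub_eq ht, hdiv 7, hdiv 13, map_one, map_ofNat]
      linear_combination (X + X ^ 2 + 2 * X ^ 3 + 13 * X ^ 6) * htwo
    simp only [hx, map_add, coeff_C_mul, coeff_X_pow, coeff_X_pow_mul', coeff_C]
    fin_cases k <;> simp

theorem exists_ne_kernel_X_sq_eq_zero (F : Type*) [Field F] [CharZero F] :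
    ∃ x₁ x₂ : F⟦X⟧, kernel (X ^ 2) x₁ = 0 ∧ kernel (X ^ 2) x₂ = 0 ∧ x₁ ≠ x₂ ∧
      (∀ k : Fin 7, coeff k x₁ = (![1, -1, 1, -2, 7 / 2, -(13 / 2), 13] : Fin 7 → F) k) ∧
      (∀ k : Fin 7, coeff k x₂ = (![1, 1, 1, 2, 7 / 2, 13 / 2, 13] : Fin 7 → F) k) := by
  obtain ⟨x, hx, hcoeff⟩ := exists_kernel_X_sq_eq_zero F
  refine ⟨rescale (-1) x, x, ?_, hx, fun h => ?_, fun k => ?_, hcoeff⟩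
  · have hX : (X : F⟦X⟧) ^ 2 = rescale (-1) (X ^ 2) := by simp [rescale_X]
    rw [hX, ← map_kernel, hx, map_zero]
  · have h₁ : coeff 1 x = 1 := hcoeff 1
    have h₂ := congrArg (coeff 1) h
    rw [coeff_rescale, h₁] at h₂
    norm_num at h₂
  · rw [coeff_rescale, hcoeff]
    fin_cases k <;> norm_num [Matrix.cons_val]

theorem expand_genFun_mul_eq_of_kernel_eq_zero {F : Type*} [Field F] {m : ℕ} (hm : m ≠ 0)
    {x y : F⟦X⟧} (hx : kernel (X ^ m) x = 0) (hy : kernel (X ^ m) y = 0) (hxy : x ≠ y) :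
    expand m hm (genFun F) *
        (x * y * X ^ m * (x * y * X ^ m - x * X ^ m - y * X ^ m + X ^ m + 1)) =
      (x - 1) * (y - 1) * (X ^ m * x * y - 1) := by
  have hV := vietaRelations_of_kernel_eq_zero hx hy hxy
  have hp := mul_ne_zero (ne_zero_of_kernel_eq_zero hx) (ne_zero_of_kernel_eq_zero hy)
  have hden : 1 - (x + y) * X ^ m - X ^ m + x * y * (X ^ m) ^ 2 ≠ 0 := fun h => by
    simpa [hm] using congrArg constantCoeff h
  linear_combination hV.mul_eq_of_mul_eq (pow_ne_zero m X_ne_zero) hden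
    (expand_genFun_mul_eq hm hp hV)

theorem sextic_X_genFun_eq_zero (F : Type*) [Field F] [CharZero F] :
    sextic X (genFun F) = 0 := by
  obtain ⟨x, y, hx, hy, hxy, -⟩ := exists_ne_kernel_X_sq_eq_zero F
  have hp := mul_ne_zero (ne_zero_of_kernel_eq_zero hx) (ne_zero_of_kernel_eq_zero hy)
  have hV := vietaRelations_of_kernel_eq_zero hx hy hxy
  have hpz : 1 - x * y * X ^ 2 ≠ 0 := fun h => by simpa using congrArg constantCoeff h
  have h := hV.sextic_eq_zero (pow_ne_zero 2 X_ne_zero) hpz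
    (expand_genFun_mul_eq two_ne_zero hp hV)
  rw [← expand_X 2 two_ne_zero] at h
  ext n
  rw [← coeff_expand_mul 2 two_ne_zero, ← AlgHom.coe_toRingHom, map_sextic, AlgHom.coe_toRingHom,
    h, map_zero, map_zero]

end Roots

section Series

open PowerSeries

/-- The inclusion of the power series in `w` in the formal series in `z`, where `w ^ 2 = z`. -/
noncomputable def sqrtSeries : ℂ⟦X⟧ →+* Series :=
  (HahnSeries.embDomainRingHom (Γ := ℕ) (Γ' := ℚ)
    ((AddMonoidHom.mulRight (1 / 2 : ℚ)).comp (Nat.castAddMonoidHom ℚ))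
    (fun m n h => by simpa using h) (fun m n => by simp)).comp
    (HahnSeries.toPowerSeries.symm : ℂ⟦X⟧ ≃+* HahnSeries ℕ ℂ).toRingHom

theorem coeff_sqrtSeries (f : ℂ⟦X⟧) (n : ℕ) : (sqrtSeries f).coeff ((n : ℚ) / 2) = coeff n f := by
  rw [div_eq_mul_one_div]
  exact (HahnSeries.embDomain_coeff (a := n)).trans HahnSeries.coeff_toPowerSeries_symm

theorem coeff_sqrtSeries_of_forall_ne (f : ℂ⟦X⟧) {q : ℚ} (hq : ∀ n : ℕ, q ≠ (n : ℚ) / 2) :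
    (sqrtSeries f).coeff q = 0 := by
  refine HahnSeries.embDomain_of_notMem_range ?_
  rintro ⟨n, hn⟩
  exact hq n (hn.symm.trans (div_eq_mul_one_div _ _).symm)

theorem coeff_ofPowerSeries_of_forall_ne (f : ℂ⟦X⟧) {q : ℚ} (hq : ∀ n : ℕ, q ≠ n) :
    (HahnSeries.ofPowerSeries ℚ ℂ f).coeff q = 0 := by
  rw [HahnSeries.ofPowerSeries_apply]
  refine HahnSeries.embDomain_of_notMem_range ?_
  rintro ⟨n, hn⟩
  exact hq n hn.symm

theorem isPowerSeriesInSqrt_sqrtSeries (f : ℂ⟦X⟧) : IsPowerSeriesInSqrt (sqrtSeries f) := by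
  intro q hq
  by_contra! h
  exact hq (coeff_sqrtSeries_of_forall_ne f h)

theorem sqrtSeries_injective : Function.Injective sqrtSeries := by
  intro f g h
  ext n
  rw [← coeff_sqrtSeries, ← coeff_sqrtSeries, h]

theorem sqrtSeries_expand_two (f : ℂ⟦X⟧) :
    sqrtSeries (expand 2 two_ne_zero f) = HahnSeries.ofPowerSeries ℚ ℂ f := by
  ext q
  by_cases hq : ∃ n : ℕ, q = n
  · obtain ⟨n, rfl⟩ := hq
    have hn : (n : ℚ) = ((2 * n : ℕ) : ℚ) / 2 := by
      push_cast
      ring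
    rw [HahnSeries.ofPowerSeries_apply_coeff, hn, coeff_sqrtSeries, coeff_expand_mul]
  push Not at hq
  rw [coeff_ofPowerSeries_of_forall_ne f hq]
  by_cases hq' : ∃ n : ℕ, q = (n : ℚ) / 2
  · obtain ⟨n, rfl⟩ := hq'
    rw [coeff_sqrtSeries, coeff_expand_of_not_dvd]
    rintro ⟨k, rfl⟩
    exact hq k (by push_cast; ring)
  · push Not at hq'
    exact coeff_sqrtSeries_of_forall_ne _ hq'

theorem sqrtSeries_X_sq : sqrtSeries (X ^ 2) = zVar := by
  rw [← expand_X 2 two_ne_zero, sqrtSeries_expand_two, HahnSeries.ofPowerSeries_X, zVar]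

/-- The subring of the formal series without negative exponents, that is, of those that do not
diverge as the variable tends to `0`. -/
def nonnegOrderSubring (Γ R : Type*) [AddCommGroup Γ] [LinearOrder Γ] [IsOrderedAddMonoid Γ]
    [Ring R] [IsDomain R] : Subring (HahnSeries Γ R) where
  carrier := {x | 0 ≤ x.orderTop}
  mul_mem' {x y} hx hy := by
    simpa [← HahnSeries.addVal_apply] using add_nonneg hx hy
  one_mem' := by simp
  add_mem' {x y} hx hy := by
    rw [Set.mem_ofPred_eq] at hx hy ⊢
    exact (le_min hx hy).trans HahnSeries.min_orderTop_le_orderTop_add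
  zero_mem' := by simp
  neg_mem' {x} hx := by simpa using hx

theorem mem_nonnegOrderSubring {Γ R : Type*} [AddCommGroup Γ] [LinearOrder Γ]
    [IsOrderedAddMonoid Γ] [Ring R] [IsDomain R] {x : HahnSeries Γ R} :
    x ∈ nonnegOrderSubring Γ R ↔ 0 ≤ x.orderTop :=
  Iff.rfl

theorem orderTop_zVar : zVar.orderTop = (1 : ℚ) :=
  HahnSeries.orderTop_single one_ne_zero

theorem zVar_mem_nonnegOrderSubring : zVar ∈ nonnegOrderSubring ℚ ℂ := by
  rw [mem_nonnegOrderSubring, orderTop_zVar]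
  exact_mod_cast zero_le_one

theorem one_add_zVar_mul_ne_zero {x : Series} (hx : x ∈ nonnegOrderSubring ℚ ℂ) :
    1 + zVar * x ≠ 0 := by
  intro h
  have hval := congrArg (HahnSeries.addVal ℚ ℂ) (eq_neg_of_add_eq_zero_left h)
  rw [AddValuation.map_neg, AddValuation.map_mul, AddValuation.map_one, HahnSeries.addVal_apply,
    HahnSeries.addVal_apply, orderTop_zVar] at hval
  have hpos : (0 : WithTop ℚ) < (1 : ℚ) := by exact_mod_cast zero_lt_one
  exact (hpos.trans_le (le_add_of_nonneg_right (mem_nonnegOrderSubring.mp hx))).ne hval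

theorem IsPowerSeriesInSqrt.mem_nonnegOrderSubring {x : Series} (hx : IsPowerSeriesInSqrt x) :
    x ∈ nonnegOrderSubring ℚ ℂ := by
  refine InvSeq.mem_nonnegOrderSubring.mpr <| HahnSeries.le_orderTop_iff_forall.mpr fun q hq => ?_
  by_contra h
  obtain ⟨k, rfl⟩ := hx q h
  have : ((k : ℚ) / 2) < 0 := by exact_mod_cast hq
  linarith [k.cast_nonneg (α := ℚ)]

theorem eq_or_eq_of_kernel_eq_zero {x y t : Series} (hx : x ∈ nonnegOrderSubring ℚ ℂ)
    (hy : y ∈ nonnegOrderSubring ℚ ℂ) (ht : t ∈ nonnegOrderSubring ℚ ℂ)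
    (hkx : kernel zVar x = 0) (hky : kernel zVar y = 0) (hxy : x ≠ y) (hkt : kernel zVar t = 0) :
    t = x ∨ t = y := by
  have hz := zVar_mem_nonnegOrderSubring
  have hp := mul_mem hx hy
  have hfactor := (vietaRelations_of_kernel_eq_zero hkx hky hxy).mul_kernel t
  rw [hkt, mul_zero, eq_comm, mul_eq_zero] at hfactor
  have hmem : x * y * zVar * t ^ 2 - x * y * (zVar + 2 - (x + y) * zVar) * t ∈
      nonnegOrderSubring ℚ ℂ :=
    sub_mem (mul_mem (mul_mem hp hz) (pow_mem ht 2))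
      (mul_mem (mul_mem hp (sub_mem (add_mem hz (ofNat_mem _ 2)) (mul_mem (add_mem hx hy) hz))) ht)
  have hquad := hfactor.resolve_right (one_add_zVar_mul_ne_zero hmem)
  have hprod : (t - x) * (t - y) = 0 := by linear_combination hquad
  exact (mul_eq_zero.mp hprod).imp sub_eq_zero.mp sub_eq_zero.mp

theorem mul_add_one_ne_zero_of_kernel_eq_zero {x y : Series} (hx : x ∈ nonnegOrderSubring ℚ ℂ)
    (hy : y ∈ nonnegOrderSubring ℚ ℂ) (hkx : kernel zVar x = 0) (hky : kernel zVar y = 0) :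
    x * y * zVar * (x * y * zVar - x * zVar - y * zVar + zVar + 1) ≠ 0 := by
  have hz : zVar ≠ 0 := HahnSeries.single_ne_zero one_ne_zero
  refine mul_ne_zero (mul_ne_zero (mul_ne_zero (ne_zero_of_kernel_eq_zero hkx)
    (ne_zero_of_kernel_eq_zero hky)) hz) ?_
  have hne := one_add_zVar_mul_ne_zero (add_mem (sub_mem (sub_mem (mul_mem hx hy) hx) hy)
    (one_mem _))
  convert hne using 1
  ring

theorem kernel_zVar_sqrtSeries {x : ℂ⟦X⟧} (hx : kernel (X ^ 2) x = 0) :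
    kernel zVar (sqrtSeries x) = 0 := by
  rw [← sqrtSeries_X_sq, ← map_kernel, hx, map_zero]

theorem ofPowerSeries_genFun_mul_eq {x y : ℂ⟦X⟧} (hx : kernel (X ^ 2) x = 0)
    (hy : kernel (X ^ 2) y = 0) (hxy : x ≠ y) :
    HahnSeries.ofPowerSeries ℚ ℂ (genFun ℂ) *
        (sqrtSeries x * sqrtSeries y * zVar * (sqrtSeries x * sqrtSeries y * zVar -
          sqrtSeries x * zVar - sqrtSeries y * zVar + zVar + 1)) =
      (sqrtSeries x - 1) * (sqrtSeries y - 1) * (zVar * sqrtSeries x * sqrtSeries y - 1) := by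
  have h := congrArg sqrtSeries (expand_genFun_mul_eq_of_kernel_eq_zero two_ne_zero hx hy hxy)
  simpa only [map_mul, map_sub, map_add, map_one, sqrtSeries_expand_two, sqrtSeries_X_sq] using h

end Series

section Irreducibility

open Polynomial

theorem irreducible_of_irreducible_map_of_leadingCoeff {R S : Type*} [CommRing R] [IsDomain R]
    [CommRing S] [IsDomain S] (φ : R →+* S) {f : R[X]} (hf : f.IsPrimitive)
    (hlead : φ f.leadingCoeff ≠ 0) (h : Irreducible (f.map φ)) : Irreducible f := by
  have isUnit_left {g k : R[X]} (hgk : f = g * k) (hg : IsUnit (g.map φ)) : IsUnit g := by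
    rw [hgk, leadingCoeff_mul, map_mul] at hlead
    have hdeg : g.natDegree = 0 :=
      (natDegree_map_of_leadingCoeff_ne_zero φ (left_ne_zero_of_mul hlead)).symm.trans
        (natDegree_eq_zero_of_isUnit hg)
    obtain ⟨c, rfl⟩ := natDegree_eq_zero.mp hdeg
    exact (hf c ⟨k, hgk⟩).map C
  refine ⟨fun hu => h.not_isUnit (hu.map (mapRingHom φ)), fun g k hgk => ?_⟩
  have hmap : f.map φ = g.map φ * k.map φ := by rw [hgk, Polynomial.map_mul]
  exact (h.isUnit_or_isUnit hmap).imp (isUnit_left hgk) (isUnit_left (hgk.trans (mul_comm g k)))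

theorem int_cubic_ne_zero (v : ℤ) : v ^ 3 - 6 * v ^ 2 + 14 * v - 16 ≠ 0 := by
  have hmod (w : ZMod 3) : w ^ 3 - 6 * w ^ 2 + 14 * w - 16 ≠ 0 := by
    revert w
    decide
  intro h
  exact hmod v (by exact_mod_cast congrArg (Int.cast : ℤ → ZMod 3) h)

theorem rat_cubic_ne_zero (u : ℚ) : 128 * u ^ 3 - 56 * u ^ 2 + 12 * u - 1 ≠ 0 := by
  intro h
  have hu : u ≠ 0 := by
    rintro rfl
    norm_num at h
  set f : ℤ[X] := X ^ 3 - 6 * X ^ 2 + 14 * X - 16 with hf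
  have hmonic : f.Monic := by
    rw [hf]
    monicity!
  have haeval (v : ℚ) : aeval v f = v ^ 3 - 6 * v ^ 2 + 14 * v - 16 := by
    simp only [hf, map_sub, map_add, map_mul, map_pow, aeval_X, map_ofNat]
  have hroot : aeval ((2 * u)⁻¹) f = 0 := by
    rw [haeval]
    field_simp
    linear_combination -h
  obtain ⟨v, hv⟩ := isInteger_of_is_root_of_monic hmonic hroot
  rw [← hv, haeval, eq_intCast] at hroot
  exact int_cubic_ne_zero v (by exact_mod_cast hroot)

theorem sextic_eq_cubic {R : Type*} [CommRing R] (z a : R) :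
    sextic z a = (3 * a ^ 6 - 2 * a ^ 5) * z ^ 3 + (-6 * a ^ 5 + 11 * a ^ 4 - 5 * a ^ 3) * z ^ 2 +
      (a ^ 6 - 3 * a ^ 5 + 5 * a ^ 4 - 7 * a ^ 3 + 6 * a ^ 2 - 2 * a) * z + -(a - 1) ^ 5 := by
  unfold sextic
  ring

theorem irreducible_sextic_X_two : Irreducible (sextic X 2 : ℚ[X]) := by
  have hcubic : (sextic X 2 : ℚ[X]) = 128 * X ^ 3 - 56 * X ^ 2 + 12 * X - 1 := by
    unfold sextic
    ring
  have hdeg : (sextic X 2 : ℚ[X]).natDegree = 3 := by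
    rw [hcubic]
    compute_degree!
  refine irreducible_of_degree_le_three_of_not_isRoot (by simp [hdeg]) fun u hu => ?_
  exact rat_cubic_ne_zero u (by simpa [hcubic, IsRoot] using hu)

theorem sextic_X_C_X_eq : (sextic X (C X) : ℚ[X][X]) =
    C (3 * X ^ 6 - 2 * X ^ 5) * X ^ 3 + C (-6 * X ^ 5 + 11 * X ^ 4 - 5 * X ^ 3) * X ^ 2 +
      C (X ^ 6 - 3 * X ^ 5 + 5 * X ^ 4 - 7 * X ^ 3 + 6 * X ^ 2 - 2 * X) * X + C (-(X - 1) ^ 5) := by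
  simp only [sextic_eq_cubic, map_sub, map_add, map_mul, map_neg, map_pow, map_ofNat, map_one]

theorem natDegree_sextic_X_C_X : (sextic X (C X) : ℚ[X][X]).natDegree = 3 := by
  have hlead : (3 * X ^ 6 - 2 * X ^ 5 : ℚ[X]) ≠ 0 := fun h => by
    have heval := congrArg (eval 1) h
    norm_num at heval
  rw [sextic_X_C_X_eq]
  compute_degree!

theorem coeff_three_sextic_X_C_X :
    (sextic X (C X) : ℚ[X][X]).coeff 3 = 3 * X ^ 6 - 2 * X ^ 5 := by
  rw [sextic_X_C_X_eq]
  simp only [coeff_add, coeff_C_mul, coeff_X_pow, coeff_C, coeff_X]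
  norm_num

theorem coeff_zero_sextic_X_C_X : (sextic X (C X) : ℚ[X][X]).coeff 0 = -(X - 1) ^ 5 := by
  rw [sextic_X_C_X_eq]
  simp only [coeff_add, coeff_C_mul, coeff_X_pow, coeff_C, coeff_X]
  norm_num

theorem isPrimitive_sextic_X_C_X : (sextic X (C X) : ℚ[X][X]).IsPrimitive := by
  intro c hc
  rw [C_dvd_iff_dvd_coeff] at hc
  have h₀ := hc 0
  have h₃ := hc 3
  rw [coeff_zero_sextic_X_C_X, dvd_neg] at h₀
  rw [coeff_three_sextic_X_C_X] at h₃
  have hcoprime : IsCoprime ((X - 1 : ℚ[X]) ^ 5) (3 * X ^ 6 - 2 * X ^ 5) := by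
    rw [show (3 * X ^ 6 - 2 * X ^ 5 : ℚ[X]) = X ^ 5 * (3 * X - 2) by ring]
    exact (IsCoprime.pow ⟨-1, 1, by ring⟩).mul_right (IsCoprime.pow_left ⟨-3, 1, by ring⟩)
  exact hcoprime.isUnit_of_dvd' h₀ h₃

theorem irreducible_sextic_X_C_X : Irreducible (sextic X (C X) : ℚ[X][X]) := by
  refine irreducible_of_irreducible_map_of_leadingCoeff (evalRingHom 2) isPrimitive_sextic_X_C_X ?_
    ?_
  · rw [leadingCoeff, natDegree_sextic_X_C_X, coeff_three_sextic_X_C_X]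
    norm_num
  · have hmap : (sextic X (C X) : ℚ[X][X]).map (evalRingHom 2) = sextic X 2 := by
      rw [← coe_mapRingHom, map_sextic]
      simp only [coe_mapRingHom, map_X, map_C, coe_evalRingHom, eval_X, map_ofNat]
    exact hmap ▸ irreducible_sextic_X_two

theorem irreducible_sextic_C_X_X : Irreducible (sextic (C X) X : ℚ[X][X]) := by
  have hswap : Bivariate.swap (sextic X (C X) : ℚ[X][X]) = (sextic (C X) X : ℚ[X][X]) := by
    simp only [sextic, map_add, map_sub, map_mul, map_pow, map_ofNat, map_one, Bivariate.swap_X,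
      Bivariate.swap_Y]
  rw [← hswap]
  exact (MulEquiv.irreducible_iff Bivariate.swap).mpr irreducible_sextic_X_C_X

theorem natDegree_sextic_C_X_X : (sextic (C X) X : ℚ[X][X]).natDegree = 6 := by
  have hlead : (3 * X ^ 3 + X : ℚ[X]) ≠ 0 := fun h => by
    have heval := congrArg (eval 1) h
    norm_num at heval
  have hsextic : (sextic (C X) X : ℚ[X][X]) = C (3 * X ^ 3 + X) * X ^ 6
      - C (2 * X ^ 3 + 6 * X ^ 2 + 3 * X + 1) * X ^ 5 + C (11 * X ^ 2 + 5 * X + 5) * X ^ 4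
      - C (5 * X ^ 2 + 7 * X + 10) * X ^ 3 + C (6 * X + 10) * X ^ 2 - C (2 * X + 5) * X + 1 := by
    simp only [sextic, map_add, map_mul, map_pow, map_ofNat, map_one]
  rw [hsextic]
  compute_degree!

theorem isAlgebraic_and_natDegree_minpoly_of_sextic_eq_zero {K L : Type*} [Field K]
    [Algebra ℚ[X] K] [IsFractionRing ℚ[X] K] [Field L] [Algebra K L] {x : L}
    (hx : sextic (algebraMap K L (algebraMap ℚ[X] K X)) x = 0) :
    IsAlgebraic K x ∧ (minpoly K x).natDegree = 6 := by
  set f := (sextic (C X) X : ℚ[X][X]).map (algebraMap ℚ[X] K) with hf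
  have hirr : Irreducible f :=
    (IsPrimitive.irreducible_iff_irreducible_map_fraction_map
      (irreducible_sextic_C_X_X.isPrimitive (by simp [natDegree_sextic_C_X_X]))).mp
      irreducible_sextic_C_X_X
  have hroot : aeval x f = 0 := by
    rw [hf, ← coe_mapRingHom, map_sextic, ← AlgHom.coe_toRingHom, map_sextic]
    simpa using hx
  refine ⟨⟨f, hirr.ne_zero, hroot⟩, ?_⟩
  rw [← minpoly.eq_of_irreducible hirr hroot, natDegree_mul_C (by simpa using hirr.ne_zero),
    natDegree_map_eq_of_injective (IsFractionRing.injective _ _), natDegree_sextic_C_X_X]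

theorem isAlgebraic_and_natDegree_minpoly_genFun :
    IsAlgebraic (RatFunc ℚ) (genFun ℚ : LaurentSeries ℚ) ∧
      (minpoly (RatFunc ℚ) (genFun ℚ : LaurentSeries ℚ)).natDegree = 6 := by
  refine isAlgebraic_and_natDegree_minpoly_of_sextic_eq_zero ?_
  have hX : algebraMap (RatFunc ℚ) (LaurentSeries ℚ) (algebraMap ℚ[X] (RatFunc ℚ) X) =
      HahnSeries.ofPowerSeries ℤ ℚ PowerSeries.X := by
    rw [RatFunc.algebraMap_X, HahnSeries.ofPowerSeries_X]
    exact RatFunc.coe_X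
  rw [hX, ← map_sextic, sextic_X_genFun_eq_zero, map_zero]

end Irreducibility

end InvSeq

theorem mainTheorem6 :
    -- the class of the triple `(-, ≠, >)` is the class avoiding `110, 120, 201, 210`
    (∀ n : ℕ, InvSeq.relClass InvSeq.noRestriction (· ≠ ·) (· > ·) n =
      InvSeq.patClass {![1, 1, 0], ![1, 2, 0], ![2, 0, 1], ![2, 1, 0]} n) ∧
    -- the two Puiseux roots of the kernel and the formula for the generating function
    (∃ X₁ X₂ : InvSeq.Series,
      InvSeq.IsPowerSeriesInSqrt X₁ ∧ InvSeq.IsPowerSeriesInSqrt X₂ ∧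
      (∀ k : Fin 7, X₁.coeff (((k : ℕ) : ℚ) / 2) =
        (![1, -1, 1, -2, 7 / 2, -(13 / 2), 13] : Fin 7 → ℂ) k) ∧
      (∀ k : Fin 7, X₂.coeff (((k : ℕ) : ℚ) / 2) =
        (![1, 1, 1, 2, 7 / 2, 13 / 2, 13] : Fin 7 → ℂ) k) ∧
      -- they are the roots without negative exponents; every other root diverges as `z → 0`
      (∀ X : InvSeq.Series,
        (InvSeq.kernel InvSeq.zVar X = 0 ∧ 0 ≤ X.orderTop) ↔ (X = X₁ ∨ X = X₂)) ∧
      X₁ * X₂ * InvSeq.zVar * (X₁ * X₂ * InvSeq.zVar - X₁ * InvSeq.zVar - X₂ * InvSeq.zVar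
        + InvSeq.zVar + 1) ≠ 0 ∧
      HahnSeries.ofPowerSeries ℚ ℂ (InvSeq.genFun ℂ) =
        ((X₁ - 1) * (X₂ - 1) * (InvSeq.zVar * X₁ * X₂ - 1)) /
          (X₁ * X₂ * InvSeq.zVar * (X₁ * X₂ * InvSeq.zVar - X₁ * InvSeq.zVar
            - X₂ * InvSeq.zVar + InvSeq.zVar + 1))) ∧
    -- the first terms of the generating function
    (∀ n : Fin 11, PowerSeries.coeff (n : ℕ) (InvSeq.genFun ℚ) =
      (![1, 1, 2, 6, 22, 90, 396, 1833, 8801, 43441, 219092] : Fin 11 → ℚ) n) ∧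
    -- the generating function is algebraic over `ℚ(z)`, of degree `6`, and a root of an explicit
    -- polynomial of that degree
    IsAlgebraic (RatFunc ℚ) (InvSeq.genFun ℚ : LaurentSeries ℚ) ∧
    (minpoly (RatFunc ℚ) (InvSeq.genFun ℚ : LaurentSeries ℚ)).natDegree = 6 ∧
    (∀ A z : PowerSeries ℚ, A = InvSeq.genFun ℚ → z = PowerSeries.X →
      (3 * z ^ 3 + z) * A ^ 6 - (2 * z ^ 3 + 6 * z ^ 2 + 3 * z + 1) * A ^ 5
        + (11 * z ^ 2 + 5 * z + 5) * A ^ 4 - (5 * z ^ 2 + 7 * z + 10) * A ^ 3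
        + (6 * z + 10) * A ^ 2 - (2 * z + 5) * A + 1 = 0) := by
  obtain ⟨x₁, x₂, hx₁, hx₂, hne, hcoeff₁, hcoeff₂⟩ := InvSeq.exists_ne_kernel_X_sq_eq_zero ℂ
  have hsqrt := InvSeq.isPowerSeriesInSqrt_sqrtSeries
  have hmem (x) := (hsqrt x).mem_nonnegOrderSubring
  have hker₁ := InvSeq.kernel_zVar_sqrtSeries hx₁
  have hker₂ := InvSeq.kernel_zVar_sqrtSeries hx₂
  have hden := InvSeq.mul_add_one_ne_zero_of_kernel_eq_zero (hmem x₁) (hmem x₂) hker₁ hker₂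
  obtain ⟨halg, hdeg⟩ := InvSeq.isAlgebraic_and_natDegree_minpoly_genFun
  refine ⟨InvSeq.relClass_eq_patClass, ⟨InvSeq.sqrtSeries x₁, InvSeq.sqrtSeries x₂, hsqrt x₁,
    hsqrt x₂, fun k => (InvSeq.coeff_sqrtSeries _ _).trans (hcoeff₁ k),
    fun k => (InvSeq.coeff_sqrtSeries _ _).trans (hcoeff₂ k), fun t => ⟨?_, ?_⟩, hden,
    (eq_div_iff hden).mpr (InvSeq.ofPowerSeries_genFun_mul_eq hx₁ hx₂ hne)⟩,
    InvSeq.coeff_genFun_lt_eleven, halg, hdeg, ?_⟩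
  · rintro ⟨hker, ht⟩
    exact InvSeq.eq_or_eq_of_kernel_eq_zero (hmem x₁) (hmem x₂)
      (InvSeq.mem_nonnegOrderSubring.mpr ht) hker₁ hker₂ (InvSeq.sqrtSeries_injective.ne hne) hker
  · rintro (rfl | rfl)
    exacts [⟨hker₁, InvSeq.mem_nonnegOrderSubring.mp (hmem x₁)⟩,
      ⟨hker₂, InvSeq.mem_nonnegOrderSubring.mp (hmem x₂)⟩]
  · rintro A z rfl rfl
    exact InvSeq.sextic_X_genFun_eq_zero ℚ
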